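/- For $A\subset\mathbb Z_+$ let $\underline d(A)=\liminf_{n\to\infty}\frac{\#\{a\in A:\ a\le n\}}{n}$ and $\overline d(A)=\limsup_{n\to\infty}\frac{\#\{a\in A:\ a\le n\}}{n}$. A bounded linear operator $T$ on a Banach space $X$ is called frequently hypercyclic (resp. $\mathcal U$-frequently hypercyclic) if there is $x\in X$ such that, for every nonempty open set $U\subset X$, the set $\{n\in\mathbb Z_+:\ T^nx\in U\}$ has positive lower density (resp. positive upper density). For a bounded sequence $\mathbf w=(w_n)_{n\ge1}$ of positive real numbers, let $B_{\mathbf w}$ be the unilateral weighted backward shift on $c_0(\mathbb Z_+)$, the bounded operator with $B_{\mathbf w}e_0=0$ and $B_{\mathbf w}e_n=w_ne_{n-1}$ for $n\ge1$, where $(e_n)_{n\ge0}$ is the standard basis. Theorem. There exists a bounded sequence $\mathbf w=(w_n)_{n\ge1}$ of positive real numbers such that (over the real as well as over the complex scalars) (i) $B_{\mathbf w}$ is $\mathcal U$-frequently hypercyclic on $c_0(\mathbb Z_+)$; (ii) $B_{\mathbf w}$ is not frequently hypercyclic on $c_0(\mathbb Z_+)$. -/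

import Mathlib

open Filter Topology
open scoped ZeroAtInfty

/-- The lower density `liminf #{a ∈ A ; a ≤ n} / n` of a set of nonnegative integers. The quotient
lies in `[0, 2]`, so that the `liminf` of real numbers is the usual one. -/
noncomputable def lowerDensity (A : Set ℕ) : ℝ :=
  liminf (fun n : ℕ => ((A ∩ Set.Iic n).ncard : ℝ) / (n : ℝ)) atTop

/-- The upper density `limsup #{a ∈ A ; a ≤ n} / n` of a set of nonnegative integers. -/
noncomputable def upperDensity (A : Set ℕ) : ℝ :=
  limsup (fun n : ℕ => ((A ∩ Set.Iic n).ncard : ℝ) / (n : ℝ)) atTop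

/-- `T` is frequently hypercyclic: there is a vector whose orbit visits each nonempty open set
along a set of times of positive lower density. -/
def IsFrequentlyHypercyclic {𝕜 X : Type*} [NormedField 𝕜] [NormedAddCommGroup X]
    [NormedSpace 𝕜 X] (T : X →L[𝕜] X) : Prop :=
  ∃ x : X, ∀ U : Set X, IsOpen U → U.Nonempty → 0 < lowerDensity {n : ℕ | (T ^ n) x ∈ U}

/-- `T` is `𝒰`-frequently hypercyclic: there is a vector whose orbit visits each nonempty open set
along a set of times of positive upper density. -/
def IsUFrequentlyHypercyclic {𝕜 X : Type*} [NormedField 𝕜] [NormedAddCommGroup X]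
    [NormedSpace 𝕜 X] (T : X →L[𝕜] X) : Prop :=
  ∃ x : X, ∀ U : Set X, IsOpen U → U.Nonempty → 0 < upperDensity {n : ℕ | (T ^ n) x ∈ U}

/-- The sequence `(w n)` with `n ≥ 1` is bounded (the value `w 0` plays no role). -/
def IsBoundedWeight (w : ℕ → ℝ) : Prop :=
  ∃ C : ℝ, ∀ n : ℕ, 1 ≤ n → |w n| ≤ C

/-- The sequence `n ↦ w (n + 1) * x (n + 1)`, as an element of `c₀`. -/
noncomputable def weightedBackwardShiftFun {𝕜 : Type*} [RCLike 𝕜] (w : ℕ → ℝ)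
    (hw : IsBoundedWeight w) (x : C₀(ℕ, 𝕜)) : C₀(ℕ, 𝕜) where
  toFun n := (w (n + 1) : 𝕜) * x (n + 1)
  continuous_toFun := continuous_of_discreteTopology
  zero_at_infty' := by
    obtain ⟨C, hC⟩ := hw
    have hx : Tendsto (fun n : ℕ => x n) atTop (𝓝 0) := by
      have h := x.zero_at_infty'
      rw [Filter.cocompact_eq_cofinite, Nat.cofinite_eq_atTop] at h
      exact h
    have hx1 : Tendsto (fun n : ℕ => C * ‖x (n + 1)‖) atTop (𝓝 0) := by
      simpa using ((hx.comp (tendsto_add_atTop_nat 1)).norm.const_mul C)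
    rw [Filter.cocompact_eq_cofinite, Nat.cofinite_eq_atTop]
    refine squeeze_zero_norm (fun n => ?_) hx1
    rw [norm_mul, RCLike.norm_ofReal]
    exact mul_le_mul_of_nonneg_right (hC (n + 1) (Nat.succ_le_succ (Nat.zero_le n)))
      (norm_nonneg _)

/-- The unilateral weighted backward shift `B_w` on `c₀(ℤ₊)`, the bounded operator
`(B_w x) n = w (n + 1) * x (n + 1)`; that is, `B_w e₀ = 0` and `B_w eₙ = w n • eₙ₋₁` for `n ≥ 1`.
Here `C₀(ℕ, 𝕜)` is the space of sequences tending to `0`, with the supremum norm. -/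
noncomputable def weightedBackwardShift (𝕜 : Type*) [RCLike 𝕜] (w : ℕ → ℝ)
    (hw : IsBoundedWeight w) : C₀(ℕ, 𝕜) →L[𝕜] C₀(ℕ, 𝕜) :=
  LinearMap.mkContinuousOfExistsBound
    { toFun := weightedBackwardShiftFun w hw
      map_add' := fun x y => by
        ext n
        exact mul_add _ _ _
      map_smul' := fun c x => by
        ext n
        exact mul_left_comm _ _ _ }
    (by
      obtain ⟨C, hC⟩ := hw
      have hC0 : 0 ≤ C := (abs_nonneg _).trans (hC 1 le_rfl)
      refine ⟨C, fun x => ?_⟩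
      rw [← ZeroAtInftyContinuousMap.norm_toBCF_eq_norm]
      refine (BoundedContinuousFunction.norm_le (by positivity)).2 fun n => ?_
      have hxn : ‖x (n + 1)‖ ≤ ‖x‖ := by
        rw [← ZeroAtInftyContinuousMap.norm_toBCF_eq_norm]
        exact x.toBCF.norm_coe_le_norm (n + 1)
      change ‖(w (n + 1) : 𝕜) * x (n + 1)‖ ≤ C * ‖x‖
      rw [norm_mul, RCLike.norm_ofReal]
      exact mul_le_mul (hC (n + 1) (Nat.succ_le_succ (Nat.zero_le n))) hxn (norm_nonneg _) hC0)

theorem weightedBackwardShift_apply (𝕜 : Type*) [RCLike 𝕜] (w : ℕ → ℝ)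
    (hw : IsBoundedWeight w) (x : C₀(ℕ, 𝕜)) (n : ℕ) :
    weightedBackwardShift 𝕜 w hw x n = (w (n + 1) : 𝕜) * x (n + 1) := rfl

/-! Write `W n` for the product of the first `n` weights, so that `(Bⁿ x) l = W (n + l) x (n + l)
/ W l`. If `x` is frequently hypercyclic, then its visiting times `n` to a small ball around `e₀`
satisfy `W n * |x n| ≥ 1 / 2` with `x n → 0`, so that `W` tends to infinity along a set of
positive lower density. The weights are chosen such that the lower density of `{n | W n ≥ 2 ^ (2 *
S)}` tends to zero as `S` grows, which excludes this (`lowerDensity_le_zero`).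

`W n` is a power of two, at least `2 ^ (2 * s)` on two kinds of indices: in the interval `[m, m +
s]` for each positive multiple `m` of a rapidly growing period `period s`, and on (slightly more
than) the block `[N s, 2 * N s)`, with `N s = blockStart s` growing faster than any geometric
sequence. It stays small elsewhere, except for short ramps, since the product at most doubles at
each step. Only the blocks before the `k`-th count when one looks at `{n | W n ≥ 2 ^ (2 * S)}` up
to `N k / 4`, and they are negligible; the remaining intervals have total density tending to zero
with `S`, because the series of the `(3 * s + 1) / period s` converges (`ncard_le_cap`).

For `𝒰`-frequent hypercyclicity, a dense sequence of targets is distributed among the blocks, one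
target for each block, each of them in infinitely many blocks. On a block with target `s` the
vector `x` repeats the target, divided by the products, with period `period s`. This gives visits
of density `1 / period s` in the block, hence positive upper density (`upperDensity_pos`). Two
visits in the same block differ by a multiple of `period s`, where `W` is at least `2 ^ (2 * s)`;
visits in different blocks differ by an index in the enlargement of the later block, where `W` is
large as well. So these copies perturb each other only slightly (`norm_scaledVector_div_sub_le`).
That different targets never share a block is what keeps the required large values of `W` sparse.
-/

/-! ### The partial products of the weights -/

/-- The period of the visiting times attached to the `s`-th target. -/
def period (s : ℕ) : ℕ := 2 ^ (3 * s + 4)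

/-- The left end of the `k`-th block `[blockStart k, 2 * blockStart k)`. -/
def blockStart (k : ℕ) : ℕ := 2 ^ ((k + 3) ^ 2)

/-- The indices at which the weights may have a partial product as large as `2 ^ (2 * s)`:
neighbourhoods of the positive multiples of `period s`, and an enlargement of the `s`-th block. -/
def zone (s : ℕ) : Set ℕ :=
  {n | (∃ j, 1 ≤ j ∧ j * period s ≤ n + 2 * s ∧ n ≤ j * period s + s) ∨
    (blockStart s ≤ 2 * n ∧ n < 2 * blockStart s)}

open Classical in
/-- The largest `2 * s` with `n ∈ zone s`. Restricting to `s ≤ n` loses nothing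
(`le_of_mem_zone`) and makes the supremum finite. -/
noncomputable def cap (n : ℕ) : ℕ :=
  ((Finset.range (n + 1)).filter (fun s => n ∈ zone s)).sup (fun s => 2 * s)

/-- The base-two logarithm of the product of the first `n` weights: the largest function that
vanishes at `0`, increases by at most `1` at each step and lies below `cap` at positive indices. -/
noncomputable def height : ℕ → ℕ
  | 0 => 0
  | n + 1 => min (height n + 1) (cap (n + 1))

lemma four_mul_lt_period (s : ℕ) : 4 * s < period s := by
  have h1 : s < 2 ^ s := Nat.lt_two_pow_self
  have h2 : 2 ^ s * 4 ≤ period s := by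
    rw [period, show (4 : ℕ) = 2 ^ 2 by norm_num, ← pow_add]
    exact Nat.pow_le_pow_right (by norm_num) (by omega)
  omega

lemma lt_period (s : ℕ) : s < period s := by
  have := four_mul_lt_period s
  omega

lemma period_pos (s : ℕ) : 0 < period s := by
  unfold period; positivity

lemma blockStart_pos (k : ℕ) : 0 < blockStart k := by
  unfold blockStart; positivity

lemma blockStart_succ (k : ℕ) : blockStart (k + 1) = 4 * (2 ^ (2 * k + 5) * blockStart k) := by
  rw [blockStart, blockStart, show (4 : ℕ) = 2 ^ 2 by norm_num, ← pow_add, ← pow_add]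
  congr 1
  ring

lemma eight_mul_blockStart_le (k : ℕ) : 8 * blockStart k ≤ blockStart (k + 1) := by
  rw [blockStart_succ]
  have h : 2 ≤ 2 ^ (2 * k + 5) := le_self_pow₀ (by norm_num) (by omega)
  nlinarith [blockStart_pos k]

lemma blockStart_mono : Monotone blockStart :=
  monotone_nat_of_le_succ fun k => by
    have := eight_mul_blockStart_le k
    omega

lemma sixteen_mul_lt_blockStart (k : ℕ) : 16 * k < blockStart k := by
  have h1 : k < 2 ^ k := Nat.lt_two_pow_self
  have h2 : 2 ^ k * 16 ≤ blockStart k := by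
    rw [blockStart, show (16 : ℕ) = 2 ^ 4 by norm_num, ← pow_add]
    exact Nat.pow_le_pow_right (by norm_num) (by nlinarith)
  omega

lemma eight_mul_blockStart_le_of_lt {i k : ℕ} (h : i < k) : 8 * blockStart i ≤ blockStart k :=
  (eight_mul_blockStart_le i).trans (blockStart_mono h)

lemma period_dvd_blockStart {s k : ℕ} (h : s ≤ k) : period s ∣ blockStart k :=
  pow_dvd_pow 2 (by nlinarith)

lemma le_of_mem_zone {s n : ℕ} (h : n ∈ zone s) : s ≤ n := by
  rcases h with ⟨j, hj, h1, -⟩ | ⟨h1, -⟩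
  · have := four_mul_lt_period s
    have : period s ≤ j * period s := Nat.le_mul_of_pos_left _ hj
    omega
  · have := sixteen_mul_lt_blockStart s
    omega

lemma le_cap {s n : ℕ} (h : n ∈ zone s) : 2 * s ≤ cap n := by
  classical
  unfold cap
  refine Finset.le_sup (f := fun s => 2 * s) ?_
  rw [Finset.mem_filter, Finset.mem_range]
  exact ⟨Nat.lt_succ_of_le (le_of_mem_zone h), h⟩

lemma exists_mem_zone {S n : ℕ} (hS : 1 ≤ S) (h : 2 * S ≤ cap n) :
    ∃ s, S ≤ s ∧ n ∈ zone s := by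
  classical
  unfold cap at h
  rw [Finset.le_sup_iff (by simp only [bot_eq_zero]; omega)] at h
  obtain ⟨s, hs, h2⟩ := h
  exact ⟨s, by omega, (Finset.mem_filter.1 hs).2⟩

lemma height_succ_le (n : ℕ) : height (n + 1) ≤ height n + 1 := min_le_left _ _

lemma height_le_cap (n : ℕ) : height n ≤ cap n := by
  cases n with
  | zero => exact Nat.zero_le _
  | succ n => exact min_le_right _ _

lemma min_le_height {lo H i : ℕ} (h : ∀ m, lo ≤ m → m ≤ lo + i → H ≤ cap m) :
    min H i ≤ height (lo + i) := by
  induction i with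
  | zero => simp
  | succ i ih =>
    have h1 := ih fun m hm hm' => h m hm (by omega)
    have h2 := h (lo + i + 1) (by omega) (by omega)
    change _ ≤ min (height (lo + i) + 1) (cap (lo + i + 1))
    omega

/-- The products are large wherever two visits to the same target in the same block differ. -/
lemma le_height_of_period {s j r : ℕ} (hj : 1 ≤ j) (hr : r ≤ s) :
    2 * s ≤ height (j * period s + r) := by
  have h0 := four_mul_lt_period s
  have h1 : period s ≤ j * period s := Nat.le_mul_of_pos_left _ hj
  have := min_le_height (lo := j * period s - 2 * s) (H := 2 * s) (i := 2 * s + r)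
    fun m hm hm' => le_cap (Or.inl ⟨j, hj, by omega, by omega⟩)
  rw [show j * period s - 2 * s + (2 * s + r) = j * period s + r by omega] at this
  omega

/-- The products are large on the `k`-th block, and also at the differences between its points
and the points of earlier blocks. -/
lemma le_height_of_block {k l : ℕ} (h1 : 3 * blockStart k ≤ 4 * l) (h2 : l < 2 * blockStart k) :
    2 * k ≤ height l := by
  have h0 := sixteen_mul_lt_blockStart k
  have := min_le_height (lo := l - 2 * k) (H := 2 * k) (i := 2 * k)
    fun m hm hm' => le_cap (Or.inr ⟨by omega, by omega⟩)
  rw [show l - 2 * k + 2 * k = l by omega] at this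
  omega

/-- The weights, with partial products `2 ^ height n`. -/
noncomputable def weight (n : ℕ) : ℝ := 2 ^ height n / 2 ^ height (n - 1)

lemma weight_pos (n : ℕ) : 0 < weight n := by
  unfold weight; positivity

lemma isBoundedWeight_weight : IsBoundedWeight weight := by
  refine ⟨2, fun n hn => ?_⟩
  obtain ⟨n, rfl⟩ := Nat.exists_eq_add_of_le' hn
  rw [abs_of_pos (weight_pos _), weight, div_le_iff₀ (by positivity), ← pow_succ']
  exact pow_le_pow_right₀ (by norm_num) (height_succ_le n)

/-! ### Sequences tending to zero -/

lemma tendsto_coe_atTop {𝕜 : Type*} [RCLike 𝕜] (x : C₀(ℕ, 𝕜)) :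
    Tendsto (fun n => x n) atTop (𝓝 0) := by
  have h := x.zero_at_infty'
  rw [Filter.cocompact_eq_cofinite, Nat.cofinite_eq_atTop] at h
  exact h

/-- A sequence tending to `0`, as an element of `c₀`. -/
def ofTendsto {𝕜 : Type*} [RCLike 𝕜] (f : ℕ → 𝕜) (hf : Tendsto f atTop (𝓝 0)) : C₀(ℕ, 𝕜) where
  toFun := f
  continuous_toFun := continuous_of_discreteTopology
  zero_at_infty' := by
    rw [Filter.cocompact_eq_cofinite, Nat.cofinite_eq_atTop]
    exact hf

lemma ofTendsto_apply {𝕜 : Type*} [RCLike 𝕜] (f : ℕ → 𝕜) (hf : Tendsto f atTop (𝓝 0)) (n : ℕ) :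
    ofTendsto f hf n = f n := rfl

lemma norm_apply_le {𝕜 : Type*} [RCLike 𝕜] (x : C₀(ℕ, 𝕜)) (n : ℕ) : ‖x n‖ ≤ ‖x‖ := by
  rw [← ZeroAtInftyContinuousMap.norm_toBCF_eq_norm]
  exact x.toBCF.norm_coe_le_norm n

lemma norm_le_of_forall {𝕜 : Type*} [RCLike 𝕜] {x : C₀(ℕ, 𝕜)} {C : ℝ} (hC : 0 ≤ C)
    (h : ∀ n, ‖x n‖ ≤ C) : ‖x‖ ≤ C := by
  rw [← ZeroAtInftyContinuousMap.norm_toBCF_eq_norm]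
  exact (BoundedContinuousFunction.norm_le hC).2 h

lemma weightedBackwardShift_pow_apply {𝕜 : Type*} [RCLike 𝕜] (n : ℕ) (x : C₀(ℕ, 𝕜)) (l : ℕ) :
    (weightedBackwardShift 𝕜 weight isBoundedWeight_weight ^ n) x l =
      2 ^ height (n + l) * x (n + l) / 2 ^ height l := by
  induction n generalizing l with
  | zero => simp
  | succ n ih =>
    rw [pow_succ', mul_apply_eq_comp, weightedBackwardShift_apply, ih, weight,
      show n + (l + 1) = n + 1 + l by ring, Nat.add_sub_cancel]
    push_cast
    field_simp

/-! ### Bounds for densities -/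

lemma ncard_inter_Iic_div_le (A : Set ℕ) (n : ℕ) :
    ((A ∩ Set.Iic n).ncard : ℝ) / (n : ℝ) ≤ 2 := by
  rcases Nat.eq_zero_or_pos n with rfl | hn
  · simp
  have h : (A ∩ Set.Iic n).ncard ≤ n + 1 := by
    refine (Set.ncard_le_ncard Set.inter_subset_right (Set.finite_Iic n)).trans ?_
    rw [← Finset.coe_Iic, Set.ncard_coe_finset, Nat.card_Iic]
  rw [div_le_iff₀ (by exact_mod_cast hn)]
  have : (A ∩ Set.Iic n).ncard ≤ 2 * n := by omega
  exact_mod_cast this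

lemma le_upperDensity {A : Set ℕ} {c : ℝ}
    (h : ∃ᶠ n : ℕ in atTop, c ≤ ((A ∩ Set.Iic n).ncard : ℝ) / (n : ℝ)) : c ≤ upperDensity A :=
  le_limsup_of_frequently_le h (isBoundedUnder_of ⟨2, ncard_inter_Iic_div_le A⟩)

lemma lowerDensity_le {A : Set ℕ} {c : ℝ}
    (h : ∃ᶠ n : ℕ in atTop, ((A ∩ Set.Iic n).ncard : ℝ) / (n : ℝ) ≤ c) : lowerDensity A ≤ c :=
  liminf_le_of_frequently_le h (isBoundedUnder_of ⟨0, fun n => by positivity⟩)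

/-! ### Failure of frequent hypercyclicity -/

lemma period_mul_le {s n j : ℕ} (hj : 1 ≤ j) (h : j * period s ≤ n + 2 * s) :
    j * period s ≤ 2 * n := by
  have := four_mul_lt_period s
  have : period s ≤ j * period s := Nat.le_mul_of_pos_left _ hj
  omega

lemma three_mul_add_one_le (s : ℕ) : 3 * s + 1 ≤ 4 ^ s := by
  induction s with
  | zero => simp
  | succ s ih => rw [pow_succ]; omega

/-- Between the blocks `k` and `k + 1`, large products occur only close to multiples of large
periods. -/
lemma ncard_le_cap {S N k : ℕ} (hS : 1 ≤ S) (hN : 2 * N < blockStart (k + 1)) :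
    (({n | 2 * S ≤ cap n} ∩ Set.Iic N).ncard : ℝ) ≤
      2 * blockStart k + N * ((1 / 2 : ℝ) ^ S / 4) := by
  classical
  set D : Finset ℕ := Finset.range (2 * blockStart k) ∪
    (Finset.Ico S (N + 1)).biUnion fun s =>
      (Finset.Icc 1 (2 * N / period s) ×ˢ Finset.range (3 * s + 1)).image
        fun p => p.1 * period s + p.2 - 2 * s with hD
  have hsub : {n | 2 * S ≤ cap n} ∩ Set.Iic N ⊆ (D : Set ℕ) := by
    rintro n ⟨hn, hnN⟩
    rw [Set.mem_Iic] at hnN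
    obtain ⟨s, hSs, hz⟩ := exists_mem_zone hS hn
    have hsn := le_of_mem_zone hz
    rw [Finset.mem_coe, hD, Finset.mem_union]
    rcases hz with ⟨j, hj, h1, h2⟩ | ⟨h1, h2⟩
    · right
      rw [Finset.mem_biUnion]
      refine ⟨s, Finset.mem_Ico.2 ⟨hSs, by omega⟩, Finset.mem_image.2
        ⟨(j, n + 2 * s - j * period s), ?_, ?_⟩⟩
      · rw [Finset.mem_product, Finset.mem_Icc, Finset.mem_range]
        refine ⟨⟨hj, (Nat.le_div_iff_mul_le (period_pos s)).2 ?_⟩, ?_⟩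
        · have := period_mul_le hj h1
          change j * period s ≤ 2 * N
          omega
        · dsimp only
          omega
      · change j * period s + (n + 2 * s - j * period s) - 2 * s = n
        omega
    · left
      have hsk : s ≤ k := by
        by_contra! hk
        have := blockStart_mono (show k + 1 ≤ s from hk)
        omega
      have := blockStart_mono hsk
      rw [Finset.mem_range]
      omega
  have hcard : D.card ≤ 2 * blockStart k +
      ∑ s ∈ Finset.Ico S (N + 1), 2 * N / period s * (3 * s + 1) := by
    refine (Finset.card_union_le _ _).trans (add_le_add (by simp) ?_)
    refine Finset.card_biUnion_le.trans (Finset.sum_le_sum fun s _ => ?_)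
    refine Finset.card_image_le.trans ?_
    simp
  have hle : ({n | 2 * S ≤ cap n} ∩ Set.Iic N).ncard ≤ D.card := by
    rw [← Set.ncard_coe_finset]
    exact Set.ncard_le_ncard hsub D.finite_toSet
  have hterm : ∀ s : ℕ, ((2 * N / period s * (3 * s + 1) : ℕ) : ℝ) ≤
      N / 8 * (1 / 2 : ℝ) ^ s := by
    intro s
    have h1 : ((2 * N / period s : ℕ) : ℝ) ≤ 2 * N / period s := by
      exact_mod_cast (Nat.cast_div_le (α := ℝ) (m := 2 * N) (n := period s))
    have h2 : ((3 * s + 1 : ℕ) : ℝ) ≤ 4 ^ s := by exact_mod_cast three_mul_add_one_le s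
    have h3 : (period s : ℝ) = 16 * (4 ^ s * 2 ^ s) := by
      rw [← mul_pow, period, pow_add, pow_mul]
      push_cast
      norm_num
      ring
    rw [Nat.cast_mul]
    calc ((2 * N / period s : ℕ) : ℝ) * ((3 * s + 1 : ℕ) : ℝ)
        ≤ (2 * N / period s) * 4 ^ s := by gcongr
      _ = N / 8 * (1 / 2 : ℝ) ^ s := by
        rw [h3, one_div, inv_pow]
        field_simp
        ring
  have hgeom : ∑ s ∈ Finset.Ico S (N + 1), (1 / 2 : ℝ) ^ s ≤ (1 / 2) ^ S / (1 - 1 / 2) :=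
    geom_sum_Ico_le_of_lt_one (by norm_num) (by norm_num)
  calc (({n | 2 * S ≤ cap n} ∩ Set.Iic N).ncard : ℝ)
      ≤ ((2 * blockStart k +
        ∑ s ∈ Finset.Ico S (N + 1), 2 * N / period s * (3 * s + 1) : ℕ) : ℝ) := by
        exact_mod_cast hle.trans hcard
    _ = 2 * blockStart k +
        ∑ s ∈ Finset.Ico S (N + 1), ((2 * N / period s * (3 * s + 1) : ℕ) : ℝ) := by
        rw [Nat.cast_add, Nat.cast_sum, Nat.cast_mul, Nat.cast_ofNat]
    _ ≤ 2 * blockStart k + ∑ s ∈ Finset.Ico S (N + 1), N / 8 * (1 / 2 : ℝ) ^ s := by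
        gcongr with s _
        exact hterm s
    _ = 2 * blockStart k + N / 8 * ∑ s ∈ Finset.Ico S (N + 1), (1 / 2 : ℝ) ^ s := by
        rw [Finset.mul_sum]
    _ ≤ 2 * blockStart k + N / 8 * ((1 / 2) ^ S / (1 - 1 / 2)) := by gcongr
    _ = _ := by ring

/-- A set along which the partial products tend to infinity has lower density zero. -/
lemma lowerDensity_le_zero {A : Set ℕ}
    (hA : ∀ H, ∃ N₀, ∀ n ∈ A, N₀ ≤ n → H ≤ height n) : lowerDensity A ≤ 0 := by
  have key : ∀ S : ℕ, lowerDensity A ≤ (1 / 2 : ℝ) ^ S := by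
    intro S
    obtain ⟨N₀, hN₀⟩ := hA (2 * (S + 1))
    refine lowerDensity_le ?_
    have hN : ∀ k : ℕ, k ≤ 2 ^ (2 * k + 5) * blockStart k := fun k =>
      calc k ≤ 2 ^ k := Nat.lt_two_pow_self.le
        _ ≤ 2 ^ (2 * k + 5) := Nat.pow_le_pow_right (by norm_num) (by omega)
        _ ≤ _ := Nat.le_mul_of_pos_right _ (blockStart_pos k)
    have htend : Tendsto (fun k : ℕ => 2 ^ (2 * k + 5) * blockStart k) atTop atTop :=
      tendsto_atTop_mono hN tendsto_id
    refine htend.frequently (Eventually.frequently ?_)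
    have hev : ∀ᶠ k : ℕ in atTop, (N₀ : ℝ) * 2 ^ (S + 2) ≤ k :=
      tendsto_natCast_atTop_atTop.eventually_ge_atTop _
    filter_upwards [hev, eventually_ge_atTop S] with k hk hkS
    have hpos := blockStart_pos k
    set N : ℕ := 2 ^ (2 * k + 5) * blockStart k with hNdef
    have hNpos : 0 < N := by positivity
    have hcount := ncard_le_cap (S := S + 1) (N := N) (k := k) (by omega)
      (by rw [blockStart_succ]; omega)
    have hsub : A ∩ Set.Iic N ⊆
        Set.Iio N₀ ∪ ({n | 2 * (S + 1) ≤ cap n} ∩ Set.Iic N) := by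
      rintro n ⟨hn, hnN⟩
      by_cases h : n < N₀
      · exact Or.inl h
      · exact Or.inr ⟨(hN₀ n hn (not_lt.1 h)).trans (height_le_cap n), hnN⟩
    have hcard : (A ∩ Set.Iic N).ncard ≤
        N₀ + ({n | 2 * (S + 1) ≤ cap n} ∩ Set.Iic N).ncard := by
      refine (Set.ncard_le_ncard hsub ((Set.finite_Iio _).union
        ((Set.finite_Iic N).inter_of_right _))).trans ((Set.ncard_union_le _ _).trans ?_)
      rw [← Finset.coe_Iio, Set.ncard_coe_finset, Nat.card_Iio]
    have h1 : (N₀ : ℝ) ≤ N * ((1 / 2 : ℝ) ^ S / 4) := by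
      have : (k : ℝ) ≤ N := by exact_mod_cast hN k
      have e : (N₀ : ℝ) = (N₀ * 2 ^ (S + 2)) * ((1 / 2 : ℝ) ^ S / 4) := by
        rw [pow_add, one_div, inv_pow]
        field_simp
        norm_num
      rw [e]
      gcongr
      exact hk.trans this
    have h2 : (2 * blockStart k : ℝ) ≤ N * ((1 / 2 : ℝ) ^ S / 4) := by
      have hp : (2 : ℝ) ^ (S + 5) ≤ 2 ^ (2 * k + 5) :=
        pow_le_pow_right₀ (by norm_num) (by omega)
      have e : (2 * blockStart k : ℝ) ≤
          (2 ^ (S + 5) * blockStart k) * ((1 / 2 : ℝ) ^ S / 4) := by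
        have : (2 ^ (S + 5) * blockStart k : ℝ) * ((1 / 2 : ℝ) ^ S / 4) = 8 * blockStart k := by
          rw [pow_add, one_div, inv_pow]
          field_simp
          norm_num
        rw [this]
        have : (0 : ℝ) ≤ blockStart k := Nat.cast_nonneg _
        linarith
      refine e.trans ?_
      rw [hNdef]
      push_cast
      gcongr
    rw [div_le_iff₀ (by exact_mod_cast hNpos)]
    have hcard' : ((A ∩ Set.Iic N).ncard : ℝ) ≤
        N₀ + ({n | 2 * (S + 1) ≤ cap n} ∩ Set.Iic N).ncard := by exact_mod_cast hcard
    have h3 : (0 : ℝ) ≤ N * (1 / 2 : ℝ) ^ S := by positivity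
    rw [pow_succ] at hcount
    nlinarith
  refine ge_of_tendsto' (tendsto_pow_atTop_nhds_zero_of_lt_one ?_ ?_) key <;> norm_num

lemma not_isFrequentlyHypercyclic (𝕜 : Type*) [RCLike 𝕜] :
    ¬ IsFrequentlyHypercyclic (weightedBackwardShift 𝕜 weight isBoundedWeight_weight) := by
  rintro ⟨x, hx⟩
  set e : C₀(ℕ, 𝕜) := ofTendsto (fun n => if n = 0 then 1 else 0)
    (tendsto_const_nhds.congr' (by
      filter_upwards [eventually_ge_atTop 1] with n hn
      rw [if_neg (by omega)])) with he
  have he0 : e 0 = 1 := by rw [he, ofTendsto_apply, if_pos rfl]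
  refine absurd (hx (Metric.ball e (1 / 2)) Metric.isOpen_ball
    (Metric.nonempty_ball.2 (by norm_num))) (not_lt.2 (lowerDensity_le_zero fun H => ?_))
  have hev : ∀ᶠ n in atTop, ‖x n‖ < (1 / 2) / 2 ^ H := by
    have := (tendsto_coe_atTop x).norm
    rw [norm_zero] at this
    exact this.eventually_lt_const (by positivity)
  obtain ⟨N₀, hN₀⟩ := eventually_atTop.1 hev
  refine ⟨N₀, fun n hn hnN => ?_⟩
  by_contra! hlt
  have h1 := norm_apply_le ((weightedBackwardShift 𝕜 weight isBoundedWeight_weight ^ n) x - e) 0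
  have h2 : ‖(weightedBackwardShift 𝕜 weight isBoundedWeight_weight ^ n) x - e‖ < 1 / 2 := by
    rw [← dist_eq_norm]
    exact hn
  rw [ZeroAtInftyContinuousMap.sub_apply, weightedBackwardShift_pow_apply, he0] at h1
  simp only [add_zero, show height 0 = 0 from rfl, pow_zero, div_one] at h1
  have h3 : ‖(2 ^ height n * x n : 𝕜)‖ < 1 / 2 := by
    rw [norm_mul, norm_pow, RCLike.norm_ofNat]
    calc (2 : ℝ) ^ height n * ‖x n‖ ≤ 2 ^ H * ‖x n‖ := by
          gcongr
          norm_num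
      _ < 2 ^ H * ((1 / 2) / 2 ^ H) := by
          have := hN₀ n hnN
          gcongr
      _ = 1 / 2 := by field_simp
  have h4 : ‖(1 : 𝕜)‖ ≤ ‖(2 ^ height n * x n : 𝕜)‖ + ‖(2 ^ height n * x n - 1 : 𝕜)‖ := by
    calc ‖(1 : 𝕜)‖ = ‖(2 ^ height n * x n : 𝕜) - (2 ^ height n * x n - 1)‖ := by
          congr 1; ring
      _ ≤ _ := norm_sub_le _ _
  rw [norm_one] at h4
  linarith

/-! ### The targets -/

lemma exists_dense_finitely_supported (𝕜 : Type*) [RCLike 𝕜] :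
    ∃ u : ℕ → ℕ → 𝕜, (∀ i, ∃ J, ∀ j, J ≤ j → u i j = 0) ∧
      ∀ (c : C₀(ℕ, 𝕜)) (ε : ℝ), 0 < ε → ∃ i, ∀ j, ‖c j - u i j‖ < ε := by
  let d : List ℕ → ℕ → 𝕜 := fun L j => (L[j]?).elim 0 (TopologicalSpace.denseSeq 𝕜)
  refine ⟨fun i => d (Denumerable.ofNat (List ℕ) i), fun i => ?_, fun c ε hε => ?_⟩
  · refine ⟨(Denumerable.ofNat (List ℕ) i).length, fun j hj => ?_⟩
    simp [d, List.getElem?_eq_none hj]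
  · have hev : ∀ᶠ n in atTop, ‖c n‖ < ε := by
      have := (tendsto_coe_atTop c).norm
      rw [norm_zero] at this
      exact this.eventually_lt_const hε
    obtain ⟨J, hJ⟩ := eventually_atTop.1 hev
    have hd : ∀ j, ∃ g, ‖c j - TopologicalSpace.denseSeq 𝕜 g‖ < ε := fun j => by
      obtain ⟨g, hg⟩ := (TopologicalSpace.denseRange_denseSeq 𝕜).exists_dist_lt (c j) hε
      exact ⟨g, by rwa [← dist_eq_norm]⟩
    choose g hg using hd
    refine ⟨Encodable.encode ((List.range J).map g), fun j => ?_⟩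
    change ‖c j - d (Denumerable.ofNat (List ℕ) (Encodable.encode ((List.range J).map g))) j‖ < ε
    rw [Denumerable.ofNat_encode]
    by_cases hj : j < J
    · simpa [d, hj] using hg j
    · have : d ((List.range J).map g) j = 0 := by
        simp [d, not_lt.1 hj]
      rw [this, sub_zero]
      exact hJ j (not_lt.1 hj)

/-- A dense sequence of finitely supported vectors, each repeated infinitely often so that the
`s`-th one can be required to have support in `[0, s]` and size at most `2 ^ s` after
multiplication by the partial products. -/
lemma exists_targets (𝕜 : Type*) [RCLike 𝕜] :
    ∃ v : ℕ → ℕ → 𝕜, (∀ s j, s < j → v s j = 0) ∧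
      (∀ s j, ‖(2 ^ height j * v s j : 𝕜)‖ ≤ 2 ^ s) ∧
      ∀ (c : C₀(ℕ, 𝕜)) (ε : ℝ), 0 < ε → ∃ᶠ s in atTop, ∀ j, ‖c j - v s j‖ < ε := by
  classical
  obtain ⟨u, hu, hdense⟩ := exists_dense_finitely_supported 𝕜
  let good : ℕ → ℕ → Prop := fun s i =>
    (∀ j, s < j → u i j = 0) ∧ ∀ j, ‖(2 ^ height j * u i j : 𝕜)‖ ≤ 2 ^ s
  refine ⟨fun s => if good s s.unpair.1 then u s.unpair.1 else 0, fun s j hj => ?_,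
    fun s j => ?_, fun c ε hε => ?_⟩
  · by_cases h : good s s.unpair.1
    · simp only [if_pos h]
      exact h.1 j hj
    · simp only [if_neg h, Pi.zero_apply]
  · by_cases h : good s s.unpair.1
    · simp only [if_pos h]
      exact h.2 j
    · simp only [if_neg h, Pi.zero_apply, mul_zero, norm_zero]
      positivity
  · obtain ⟨i, hi⟩ := hdense c ε hε
    obtain ⟨J, hJ⟩ := hu i
    have hsum : ∀ j, ‖(2 ^ height j * u i j : 𝕜)‖ ≤
        ∑ j ∈ Finset.range J, ‖(2 ^ height j * u i j : 𝕜)‖ := by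
      intro j
      by_cases hj : j < J
      · exact Finset.single_le_sum (f := fun j => ‖(2 ^ height j * u i j : 𝕜)‖)
          (fun _ _ => norm_nonneg _) (Finset.mem_range.2 hj)
      · rw [hJ j (not_lt.1 hj), mul_zero, norm_zero]
        exact Finset.sum_nonneg fun _ _ => norm_nonneg _
    have hpow : ∀ᶠ s : ℕ in atTop,
        ∑ j ∈ Finset.range J, ‖(2 ^ height j * u i j : 𝕜)‖ ≤ 2 ^ s :=
      (tendsto_pow_atTop_atTop_of_one_lt one_lt_two).eventually_ge_atTop _
    have hpair : Tendsto (fun t => Nat.pair i t) atTop atTop :=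
      tendsto_atTop_mono (fun t => Nat.right_le_pair i t) tendsto_id
    refine hpair.frequently (Eventually.frequently ?_)
    filter_upwards [hpair.eventually hpow, hpair.eventually (eventually_ge_atTop J)] with t h1 h2 j
    have hgood : good (Nat.pair i t) (Nat.pair i t).unpair.1 := by
      rw [Nat.unpair_pair]
      exact ⟨fun j hj => hJ j (by omega), fun j => (hsum j).trans h1⟩
    simp only [if_pos hgood]
    rw [Nat.unpair_pair]
    exact hi j

/-! ### A `𝒰`-frequently hypercyclic vector -/

/-- The index of the target visited in the `k`-th block; each value is taken infinitely often. -/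
def targetIndex (k : ℕ) : ℕ := k.unpair.1

lemma targetIndex_le (k : ℕ) : targetIndex k ≤ k := Nat.unpair_left_le k

lemma block_unique {i k n : ℕ} (hi : blockStart i ≤ n) (hi' : n < 2 * blockStart i)
    (hk : blockStart k ≤ n) (hk' : n < 2 * blockStart k) : i = k := by
  rcases lt_trichotomy i k with h | h | h
  · have := eight_mul_blockStart_le_of_lt h
    omega
  · exact h
  · have := eight_mul_blockStart_le_of_lt h
    omega

open Classical in
/-- The coordinates, multiplied by the partial products of the weights, of the hypercyclic vector:
on the `k`-th block, the periodic repetition of the rescaled target `v (targetIndex k)`, and zero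
outside the blocks. -/
noncomputable def scaledVector {𝕜 : Type*} [RCLike 𝕜] (v : ℕ → ℕ → 𝕜) (n : ℕ) : 𝕜 :=
  if h : ∃ k, blockStart k ≤ n ∧ n < 2 * blockStart k then
    2 ^ height (n % period (targetIndex h.choose)) *
      v (targetIndex h.choose) (n % period (targetIndex h.choose))
  else 0

lemma scaledVector_of_mem {𝕜 : Type*} [RCLike 𝕜] (v : ℕ → ℕ → 𝕜) {n k : ℕ}
    (h1 : blockStart k ≤ n) (h2 : n < 2 * blockStart k) :
    scaledVector v n = 2 ^ height (n % period (targetIndex k)) *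
      v (targetIndex k) (n % period (targetIndex k)) := by
  have h : ∃ k, blockStart k ≤ n ∧ n < 2 * blockStart k := ⟨k, h1, h2⟩
  have hk : h.choose = k := block_unique h.choose_spec.1 h.choose_spec.2 h1 h2
  rw [scaledVector, dif_pos h, hk]

lemma scaledVector_of_forall_not_mem {𝕜 : Type*} [RCLike 𝕜] (v : ℕ → ℕ → 𝕜) {n : ℕ}
    (h : ¬ ∃ k, blockStart k ≤ n ∧ n < 2 * blockStart k) : scaledVector v n = 0 := by
  rw [scaledVector, dif_neg h]

lemma norm_div_two_pow_le {𝕜 : Type*} [RCLike 𝕜] {y : 𝕜} {s h : ℕ} (hy : ‖y‖ ≤ 2 ^ s)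
    (hh : 2 * s ≤ h) : ‖y / 2 ^ h‖ ≤ (1 / 2) ^ s := by
  rw [norm_div, norm_pow, RCLike.norm_ofNat]
  calc ‖y‖ / 2 ^ h ≤ 2 ^ s / 2 ^ (2 * s) := by
        gcongr
        norm_num
    _ = (1 / 2) ^ s := by
        rw [two_mul, pow_add, one_div, inv_pow]
        field_simp

section

variable {𝕜 : Type*} [RCLike 𝕜] {v : ℕ → ℕ → 𝕜}

lemma norm_scaledVector_le (hv : ∀ s j, ‖(2 ^ height j * v s j : 𝕜)‖ ≤ 2 ^ s) {n k : ℕ}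
    (h1 : blockStart k ≤ n) (h2 : n < 2 * blockStart k) :
    ‖scaledVector v n‖ ≤ 2 ^ k := by
  rw [scaledVector_of_mem v h1 h2]
  exact (hv _ _).trans (pow_le_pow_right₀ (by norm_num) (targetIndex_le k))

lemma tendsto_scaledVector_div (hv : ∀ s j, ‖(2 ^ height j * v s j : 𝕜)‖ ≤ 2 ^ s) :
    Tendsto (fun n => scaledVector v n / 2 ^ height n) atTop (𝓝 0) := by
  rw [NormedAddGroup.tendsto_nhds_zero]
  intro ε hε
  obtain ⟨K, hK⟩ := exists_pow_lt_of_lt_one hε (show (1 / 2 : ℝ) < 1 by norm_num)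
  filter_upwards [eventually_ge_atTop (2 * blockStart K)] with n hn
  by_cases h : ∃ k, blockStart k ≤ n ∧ n < 2 * blockStart k
  · obtain ⟨k, h1, h2⟩ := h
    have hKk : K ≤ k := by
      by_contra! hlt
      have := blockStart_mono hlt.le
      omega
    refine (norm_div_two_pow_le (norm_scaledVector_le hv h1 h2)
      (le_height_of_block (by omega) h2)).trans_lt (lt_of_le_of_lt ?_ hK)
    exact pow_le_pow_of_le_one (by norm_num) (by norm_num) hKk
  · rw [scaledVector_of_forall_not_mem v h, zero_div, norm_zero]
    exact hε

/-- At a time in the `k`-th block that is a multiple of the period, the orbit is close to the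
target of the block. -/
lemma norm_scaledVector_div_sub_le (hv0 : ∀ s j, s < j → v s j = 0)
    (hv : ∀ s j, ‖(2 ^ height j * v s j : 𝕜)‖ ≤ 2 ^ s) {n k : ℕ} (h1 : blockStart k ≤ n)
    (h2 : n < 2 * blockStart k) (hn : period (targetIndex k) ∣ n) (l : ℕ) :
    ‖scaledVector v (n + l) / 2 ^ height l - v (targetIndex k) l‖ ≤
      (1 / 2) ^ targetIndex k := by
  set s := targetIndex k with hs
  have hsk : s ≤ k := targetIndex_le k
  have hmod : (n + l) % period s = l % period s := by
    rw [Nat.add_mod, Nat.mod_eq_zero_of_dvd hn, zero_add, Nat.mod_mod]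
  have hpos : (0 : ℝ) ≤ (1 / 2) ^ s := by positivity
  by_cases hin : n + l < 2 * blockStart k
  · rw [scaledVector_of_mem v (by omega) hin, ← hs, hmod]
    by_cases hl : l < period s
    · rw [Nat.mod_eq_of_lt hl, mul_div_cancel_left₀ _ (pow_ne_zero _ two_ne_zero), sub_self,
        norm_zero]
      exact hpos
    · have hls : v s l = 0 := hv0 s l (by have := lt_period s; omega)
      rw [hls, sub_zero]
      by_cases hr : l % period s ≤ s
      · refine norm_div_two_pow_le (hv _ _) ?_
        have := le_height_of_period (s := s) (j := l / period s)
          ((Nat.one_le_div_iff (period_pos s)).2 (not_lt.1 hl)) hr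
        rwa [Nat.div_add_mod'] at this
      · rw [hv0 s _ (not_le.1 hr), mul_zero, zero_div, norm_zero]
        exact hpos
  · -- The end of the block is a multiple of the period, so the target fits before it.
    have hl : period s ≤ l := by
      have hd : period s ∣ 2 * blockStart k - n :=
        Nat.dvd_sub (Dvd.dvd.mul_left (period_dvd_blockStart hsk) 2) hn
      have := Nat.le_of_dvd (by omega) hd
      omega
    have hls : v s l = 0 := hv0 s l (by have := lt_period s; omega)
    rw [hls, sub_zero]
    by_cases h : ∃ i, blockStart i ≤ n + l ∧ n + l < 2 * blockStart i
    · obtain ⟨i, hi1, hi2⟩ := h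
      have hki : k < i := by
        by_contra! hle
        have := blockStart_mono hle
        omega
      have := eight_mul_blockStart_le_of_lt hki
      refine (norm_div_two_pow_le (norm_scaledVector_le hv hi1 hi2)
        (le_height_of_block (by omega) (by omega))).trans ?_
      exact pow_le_pow_of_le_one (by norm_num) (by norm_num) (hsk.trans hki.le)
    · rw [scaledVector_of_forall_not_mem v h, zero_div, norm_zero]
      exact hpos

end

/-- A set containing, for all blocks with target `s`, the multiples of the period in the block
has positive upper density. -/
lemma upperDensity_pos {A : Set ℕ} (s : ℕ)
    (hA : ∀ k n, targetIndex k = s → blockStart k ≤ n → n < 2 * blockStart k → period s ∣ n →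
      n ∈ A) : 0 < upperDensity A := by
  have hper : (0 : ℝ) < period s := by exact_mod_cast period_pos s
  refine lt_of_lt_of_le (show (0 : ℝ) < 1 / (2 * period s) by positivity) (le_upperDensity ?_)
  have htend : Tendsto (fun t => 2 * blockStart (Nat.pair s t)) atTop atTop := by
    refine tendsto_atTop_mono (fun t => ?_) tendsto_id
    have := sixteen_mul_lt_blockStart (Nat.pair s t)
    have := Nat.right_le_pair s t
    simp only [id]
    omega
  refine htend.frequently (Frequently.of_forall fun t => ?_)
  set k := Nat.pair s t with hk
  have hks : targetIndex k = s := by rw [targetIndex, hk, Nat.unpair_pair]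
  obtain ⟨q, hq⟩ := period_dvd_blockStart (hks ▸ targetIndex_le k)
  have hsub : (((Finset.range q).image fun j => blockStart k + period s * j : Finset ℕ) : Set ℕ) ⊆
      A ∩ Set.Iic (2 * blockStart k) := by
    intro n hn
    rw [Finset.mem_coe, Finset.mem_image] at hn
    obtain ⟨j, hj, rfl⟩ := hn
    rw [Finset.mem_range] at hj
    have hlt : period s * j < blockStart k := by
      rw [hq]
      exact Nat.mul_lt_mul_of_pos_left hj (period_pos s)
    refine ⟨hA k _ hks (by omega) (by omega) ?_, ?_⟩
    · exact dvd_add ⟨q, hq⟩ (dvd_mul_right _ _)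
    · rw [Set.mem_Iic]
      omega
  have hcard : q ≤ (A ∩ Set.Iic (2 * blockStart k)).ncard := by
    have h := Set.ncard_le_ncard hsub ((Set.finite_Iic _).inter_of_right _)
    rw [Set.ncard_coe_finset, Finset.card_image_of_injective, Finset.card_range] at h
    · exact h
    · intro a b hab
      exact Nat.eq_of_mul_eq_mul_left (period_pos s) (Nat.add_left_cancel hab)
  have hstart : (0 : ℝ) < blockStart k := by exact_mod_cast blockStart_pos k
  push_cast
  rw [div_le_div_iff₀ (by positivity) (by positivity)]
  have hq' : (blockStart k : ℝ) = period s * q := by exact_mod_cast hq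
  have hcard' : (q : ℝ) ≤ (A ∩ Set.Iic (2 * blockStart k)).ncard := by exact_mod_cast hcard
  rw [hq']
  nlinarith

lemma isUFrequentlyHypercyclic (𝕜 : Type*) [RCLike 𝕜] :
    IsUFrequentlyHypercyclic (weightedBackwardShift 𝕜 weight isBoundedWeight_weight) := by
  obtain ⟨v, hv0, hv, hdense⟩ := exists_targets 𝕜
  refine ⟨ofTendsto _ (tendsto_scaledVector_div hv), fun U hU hne => ?_⟩
  obtain ⟨c, hc⟩ := hne
  obtain ⟨ε, hε, hball⟩ := Metric.isOpen_iff.1 hU c hc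
  have hsmall : ∀ᶠ s : ℕ in atTop, (1 / 2 : ℝ) ^ s < ε / 4 :=
    (tendsto_pow_atTop_nhds_zero_of_lt_one (by norm_num)
      (by norm_num)).eventually_lt_const (by positivity)
  obtain ⟨s, hs, hsε⟩ := ((hdense c (ε / 4) (by positivity)).and_eventually hsmall).exists
  refine upperDensity_pos s fun k n hks h1 h2 hn => hball ?_
  rw [Metric.mem_ball, dist_eq_norm]
  refine (norm_le_of_forall (C := ε / 2) (by positivity) fun l => ?_).trans_lt (by linarith)
  have key := norm_scaledVector_div_sub_le hv0 hv h1 h2 (hks ▸ hn) l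
  rw [hks] at key
  rw [ZeroAtInftyContinuousMap.sub_apply, weightedBackwardShift_pow_apply, ofTendsto_apply,
    mul_div_cancel₀ _ (pow_ne_zero _ two_ne_zero)]
  calc ‖scaledVector v (n + l) / 2 ^ height l - c l‖
      = ‖(scaledVector v (n + l) / 2 ^ height l - v s l) - (c l - v s l)‖ := by
        rw [sub_sub_sub_cancel_right]
    _ ≤ ‖scaledVector v (n + l) / 2 ^ height l - v s l‖ + ‖c l - v s l‖ := norm_sub_le _ _
    _ ≤ ε / 2 := by linarith [hs l]

theorem theorem3 :
    ∃ (w : ℕ → ℝ) (hw : IsBoundedWeight w), (∀ n : ℕ, 1 ≤ n → 0 < w n) ∧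
      ∀ (𝕜 : Type*) [RCLike 𝕜],
        IsUFrequentlyHypercyclic (weightedBackwardShift 𝕜 w hw) ∧
          ¬ IsFrequentlyHypercyclic (weightedBackwardShift 𝕜 w hw) :=
  ⟨weight, isBoundedWeight_weight, fun n _ => weight_pos n, fun 𝕜 _ =>
    ⟨isUFrequentlyHypercyclic 𝕜, not_isFrequentlyHypercyclic 𝕜⟩⟩
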